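/- Let $\mathcal X$ be a real or complex Banach space with $\dim\mathcal X\ge 2$. Let $\mathcal N$ be a nest on $\mathcal X$, that is, a chain of closed subspaces of $\mathcal X$ that contains $\{0\}$ and $\mathcal X$ and is closed under arbitrary intersections and arbitrary closed linear spans. Let $\mathrm{Alg}\,\mathcal N$ be the algebra of all bounded linear operators on $\mathcal X$ that leave every member of $\mathcal N$ invariant. For $N\in\mathcal N$ let $N_-$ be the closed linear span of all $M\in\mathcal N$ with $M\subsetneq N$, and assume that every $N\in\mathcal N$ with $N_-=N$ is complemented in $\mathcal X$. Let $\tau,\delta,\rho:\mathrm{Alg}\,\mathcal N\to\mathrm{Alg}\,\mathcal N$ be linear maps (not assumed continuous). (i) $\tau$ satisfies $AB=0\Rightarrow A\tau(B)=0$ for all $A,B\in\mathrm{Alg}\,\mathcal N$ if and only if there is $D\in\mathrm{Alg}\,\mathcal N$ such that $\tau(A)=AD$ for all $A\in\mathrm{Alg}\,\mathcal N$. (ii) $\delta$ satisfies $AB=0\Rightarrow \delta(A)B=0$ for all $A,B\in\mathrm{Alg}\,\mathcal N$ if and only if there is $D\in\mathrm{Alg}\,\mathcal N$ such that $\delta(A)=DA$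 for all $A\in\mathrm{Alg}\,\mathcal N$. (iii) $\rho$ satisfies $AB=0\Rightarrow A\rho(B)=\rho(A)B=0$ for all $A,B\in\mathrm{Alg}\,\mathcal N$ if and only if there is $D\in\mathrm{Alg}\,\mathcal N$ such that $\rho(A)=AD$ and $AD=DA$ for all $A\in\mathrm{Alg}\,\mathcal N$. -/

import Mathlib

section NestAlgebra

variable {𝕜 X : Type*} [RCLike 𝕜] [NormedAddCommGroup X] [NormedSpace 𝕜 X]

/-- A nest on `X`: a chain of closed subspaces containing `{0}` and `X`, and closed under
arbitrary intersections and arbitrary closed linear spans. -/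
structure IsNest (𝒩 : Set (Submodule 𝕜 X)) : Prop where
  isClosed : ∀ N ∈ 𝒩, IsClosed (N : Set X)
  isChain : IsChain (· ≤ ·) 𝒩
  bot_mem : ⊥ ∈ 𝒩
  top_mem : ⊤ ∈ 𝒩
  sInf_mem : ∀ S ⊆ 𝒩, sInf S ∈ 𝒩
  closure_sSup_mem : ∀ S ⊆ 𝒩, (sSup S).topologicalClosure ∈ 𝒩

/-- `N₋`, the closed linear span of all members of `𝒩` strictly contained in `N`. -/
def nestPred (𝒩 : Set (Submodule 𝕜 X)) (N : Submodule 𝕜 X) : Submodule 𝕜 X :=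
  (sSup {M | M ∈ 𝒩 ∧ M < N}).topologicalClosure

/-- `Alg 𝒩`, the algebra of all bounded operators on `X` leaving every member of `𝒩`
invariant. -/
def nestAlgebra (𝒩 : Set (Submodule 𝕜 X)) : Subalgebra 𝕜 (X →L[𝕜] X) where
  carrier := {T | ∀ N ∈ 𝒩, ∀ x ∈ N, T x ∈ N}
  mul_mem' hS hT N hN x hx := hS N hN _ (hT N hN x hx)
  add_mem' hS hT N hN x hx := N.add_mem (hS N hN x hx) (hT N hN x hx)
  algebraMap_mem' c N _ x hx := by
    simpa [Algebra.algebraMap_eq_smul_one] using N.smul_mem c hx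

end NestAlgebra

/-! For an idempotent p, the zero products (1 - p)(pb) and p(b - pb) force τ(pb) = pτ(b); hence
τ(rb) = rτ(b) for r in the algebra generated by idempotents. All operators R = f ⊗ x with x ∈ N and
f vanishing on N₋ lie there (`IsNest.rankOne_mem_adjoin`), and RA has the same form, so Rτ(A) =
τ(RA) = RAτ(1). These R separate elements of Alg 𝒩, giving τ(A) = Aτ(1). Part (ii) is the mirror
image; (iii) combines both. -/

section IdempotentMultipliers

variable {𝕜 𝒜 : Type*} [CommRing 𝕜] [Ring 𝒜] [Algebra 𝕜 𝒜]

/-- A linear map with `a * b = 0 → a * τ b = 0` commutes with left multiplication by elements of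
the subalgebra generated by the idempotents. -/
theorem map_mul_left_of_mem_adjoin_idempotents {τ : 𝒜 →ₗ[𝕜] 𝒜}
    (hτ : ∀ a b, a * b = 0 → a * τ b = 0) {r : 𝒜}
    (hr : r ∈ Algebra.adjoin 𝕜 {p : 𝒜 | IsIdempotentElem p}) (b : 𝒜) :
    τ (r * b) = r * τ b := by
  induction hr using Algebra.adjoin_induction generalizing b with
  | mem p hp =>
    have hp : p * p = p := hp
    have h₁ := hτ (1 - p) (p * b) (by rw [← mul_assoc, sub_mul, one_mul, hp, sub_self, zero_mul])
    have h₂ := hτ p (b - p * b) (by rw [mul_sub, ← mul_assoc, hp, sub_self])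
    rw [sub_mul, one_mul, sub_eq_zero] at h₁
    rw [map_sub, mul_sub, sub_eq_zero] at h₂
    rw [h₁, h₂]
  | algebraMap c => simp [Algebra.algebraMap_eq_smul_one]
  | add x y _ _ hx hy => rw [add_mul, map_add, hx, hy, add_mul]
  | mul x y _ _ hx hy => rw [mul_assoc, hx, hy, mul_assoc]

/-- A linear map with `a * b = 0 → δ a * b = 0` commutes with right multiplication by elements of
the subalgebra generated by the idempotents. -/
theorem map_mul_right_of_mem_adjoin_idempotents {δ : 𝒜 →ₗ[𝕜] 𝒜}
    (hδ : ∀ a b, a * b = 0 → δ a * b = 0) {r : 𝒜}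
    (hr : r ∈ Algebra.adjoin 𝕜 {p : 𝒜 | IsIdempotentElem p}) (a : 𝒜) :
    δ (a * r) = δ a * r := by
  induction hr using Algebra.adjoin_induction generalizing a with
  | mem p hp =>
    have hp : p * p = p := hp
    have h₁ := hδ (a * p) (1 - p) (by rw [mul_assoc, mul_sub, mul_one, hp, sub_self, mul_zero])
    have h₂ := hδ (a - a * p) p (by rw [sub_mul, mul_assoc, hp, sub_self])
    rw [mul_sub, mul_one, sub_eq_zero] at h₁
    rw [map_sub, sub_mul, sub_eq_zero] at h₂
    rw [h₁, h₂]
  | algebraMap c => simp [Algebra.algebraMap_eq_smul_one]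
  | add x y _ _ hx hy => rw [mul_add, map_add, hx, hy, mul_add]
  | mul x y _ _ hx hy => rw [← mul_assoc, hy, hx, mul_assoc]

end IdempotentMultipliers

section NestRankOne

variable {𝕜 X : Type*} [RCLike 𝕜] [NormedAddCommGroup X] [NormedSpace 𝕜 X]

/-- A point outside a closed subspace is separated from it by a functional vanishing on the
subspace. -/
theorem Submodule.exists_strongDual_ne_zero_of_notMem {M : Submodule 𝕜 X}
    (hM : IsClosed (M : Set X)) {y : X} (hy : y ∉ M) :
    ∃ f : StrongDual 𝕜 X, (∀ x ∈ M, f x = 0) ∧ f y ≠ 0 := by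
  have : IsClosed (M : Set X) := hM
  have hne : M.mkQL y ≠ 0 := by simpa using hy
  obtain ⟨g, hg⟩ := SeparatingDual.exists_ne_zero (R := 𝕜) hne
  refine ⟨g.comp M.mkQL, fun x hx => ?_, hg⟩
  have : M.mkQL x = 0 := by simpa using hx
  rw [ContinuousLinearMap.comp_apply, this, map_zero]

theorem isClosed_nestPred (𝒩 : Set (Submodule 𝕜 X)) (N : Submodule 𝕜 X) :
    IsClosed (nestPred 𝒩 N : Set X) :=
  Submodule.isClosed_topologicalClosure _

theorem le_nestPred {𝒩 : Set (Submodule 𝕜 X)} {M N : Submodule 𝕜 X} (hM : M ∈ 𝒩) (h : M < N) :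
    M ≤ nestPred 𝒩 N :=
  (le_sSup (a := M) (s := {M | M ∈ 𝒩 ∧ M < N}) ⟨hM, h⟩).trans (Submodule.le_topologicalClosure _)

theorem IsNest.nestPred_le {𝒩 : Set (Submodule 𝕜 X)} (h𝒩 : IsNest 𝒩) {N : Submodule 𝕜 X}
    (hN : N ∈ 𝒩) : nestPred 𝒩 N ≤ N :=
  Submodule.topologicalClosure_minimal _ (sSup_le fun _ hM => hM.2.le) (h𝒩.isClosed N hN)

theorem IsNest.smulRight_mem {𝒩 : Set (Submodule 𝕜 X)} (h𝒩 : IsNest 𝒩) {N : Submodule 𝕜 X}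
    (hN : N ∈ 𝒩) {x : X} (hx : x ∈ N) {f : StrongDual 𝕜 X} (hf : ∀ y ∈ nestPred 𝒩 N, f y = 0) :
    f.smulRight x ∈ nestAlgebra 𝒩 := by
  intro M hM y hy
  by_cases hNM : N ≤ M
  · exact M.smul_mem _ (hNM hx)
  · have hMN : M ≤ N := (h𝒩.isChain.total hM hN).resolve_right hNM
    have hfy := hf y (le_nestPred hM (lt_of_le_not_ge hMN hNM) hy)
    simp [hfy]

/-- The rank one operator `y ↦ f y • x` as an element of the nest algebra. -/
def IsNest.rankOne {𝒩 : Set (Submodule 𝕜 X)} (h𝒩 : IsNest 𝒩) {N : Submodule 𝕜 X}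
    (hN : N ∈ 𝒩) {x : X} (hx : x ∈ N) {f : StrongDual 𝕜 X} (hf : ∀ y ∈ nestPred 𝒩 N, f y = 0) :
    nestAlgebra 𝒩 :=
  ⟨f.smulRight x, h𝒩.smulRight_mem hN hx hf⟩

theorem IsNest.rankOne_apply {𝒩 : Set (Submodule 𝕜 X)} (h𝒩 : IsNest 𝒩) {N : Submodule 𝕜 X}
    (hN : N ∈ 𝒩) {x : X} (hx : x ∈ N) {f : StrongDual 𝕜 X} (hf : ∀ y ∈ nestPred 𝒩 N, f y = 0)
    (z : X) : (h𝒩.rankOne hN hx hf : X →L[𝕜] X) z = f z • x :=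
  rfl

theorem nestAlgebra_ext {𝒩 : Set (Submodule 𝕜 X)} {S T : nestAlgebra 𝒩}
    (h : ∀ z, (S : X →L[𝕜] X) z = (T : X →L[𝕜] X) z) : S = T :=
  Subtype.ext (ContinuousLinearMap.ext h)

section

variable {𝒩 : Set (Submodule 𝕜 X)} (h𝒩 : IsNest 𝒩) {N : Submodule 𝕜 X} (hN : N ∈ 𝒩)
  {x : X} (hx : x ∈ N) {f : StrongDual 𝕜 X} (hf : ∀ y ∈ nestPred 𝒩 N, f y = 0)

/-- Since R² = f(x)R, the multiple f(x)⁻¹R is idempotent. -/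
theorem IsNest.rankOne_mem_adjoin_of_apply_ne_zero (hfx : f x ≠ 0) :
    h𝒩.rankOne hN hx hf ∈ Algebra.adjoin 𝕜 {P : nestAlgebra 𝒩 | IsIdempotentElem P} := by
  have key : (f x)⁻¹ • h𝒩.rankOne hN hx hf ∈
      Algebra.adjoin 𝕜 {P : nestAlgebra 𝒩 | IsIdempotentElem P} := by
    refine Algebra.subset_adjoin (nestAlgebra_ext fun z => ?_)
    simp only [rankOne_apply, smul_smul, MulMemClass.coe_mul, SetLike.val_smul,
      mul_apply_eq_comp, smul_apply, map_smul]
    congr 1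
    field_simp
  simpa [smul_smul, hfx] using Subalgebra.smul_mem _ key (f x)

theorem IsNest.rankOne_mem_adjoin_of_exists_apply_ne_zero (h : ∃ y ∈ N, f y ≠ 0) :
    h𝒩.rankOne hN hx hf ∈ Algebra.adjoin 𝕜 {P : nestAlgebra 𝒩 | IsIdempotentElem P} := by
  by_cases hfx : f x = 0
  · obtain ⟨y, hy, hfy⟩ := h
    have h₁ := h𝒩.rankOne_mem_adjoin_of_apply_ne_zero hN (N.add_mem hx hy) hf
      (by simpa [hfx] using hfy)
    -- f ⊗ x = f ⊗ (x + y) - f ⊗ y, and f is nonzero at both vectors.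
    have h₂ := h𝒩.rankOne_mem_adjoin_of_apply_ne_zero hN hy hf hfy
    convert sub_mem h₁ h₂ using 1
    exact nestAlgebra_ext fun z => by simp [rankOne_apply]
  · exact h𝒩.rankOne_mem_adjoin_of_apply_ne_zero hN hx hf hfx

/-- Dual trick: perturb the functional instead of the vector. -/
theorem IsNest.rankOne_mem_adjoin_of_exists_functional
    (h : ∃ g : StrongDual 𝕜 X, (∀ y ∈ nestPred 𝒩 N, g y = 0) ∧ g x ≠ 0) :
    h𝒩.rankOne hN hx hf ∈ Algebra.adjoin 𝕜 {P : nestAlgebra 𝒩 | IsIdempotentElem P} := by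
  by_cases hfx : f x = 0
  · obtain ⟨g, hg, hgx⟩ := h
    have h₁ := h𝒩.rankOne_mem_adjoin_of_apply_ne_zero hN hx (f := f + g)
      (fun y hy => by simp [hf y hy, hg y hy]) (by simpa [hfx] using hgx)
    have h₂ := h𝒩.rankOne_mem_adjoin_of_apply_ne_zero hN hx hg hgx
    convert sub_mem h₁ h₂ using 1
    exact nestAlgebra_ext fun z => by simp [rankOne_apply, add_smul]
  · exact h𝒩.rankOne_mem_adjoin_of_apply_ne_zero hN hx hf hfx

/-- A rank one operator with range in a complemented `N ∈ 𝒩` and kernel containing `N` is a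
difference of two idempotents of the nest algebra. -/
theorem IsNest.rankOne_mem_adjoin_of_closedComplemented (hc : N.ClosedComplemented)
    (hfN : ∀ y ∈ N, f y = 0) :
    h𝒩.rankOne hN hx hf ∈ Algebra.adjoin 𝕜 {P : nestAlgebra 𝒩 | IsIdempotentElem P} := by
  obtain ⟨π, hπ⟩ := hc
  have hπN : ∀ y ∈ N, (π y : X) = y := fun y hy => congrArg Subtype.val (hπ ⟨y, hy⟩)
  have hmem : N.subtypeL.comp π ∈ nestAlgebra 𝒩 := by
    intro M hM y hy
    rcases h𝒩.isChain.total hM hN with h | h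
    · simpa [hπN y (h hy)] using hy
    · exact h (π y).2
  let P : nestAlgebra 𝒩 := ⟨N.subtypeL.comp π, hmem⟩
  have hP : ∀ z, (P : X →L[𝕜] X) z = (π z : X) := fun _ => rfl
  have h₁ : IsIdempotentElem P := nestAlgebra_ext fun z => by simp [hP, hπN]
  -- PR = R as x ∈ N, while RP = R² = 0 as f kills N.
  have h₂ : IsIdempotentElem (P + h𝒩.rankOne hN hx hf) := nestAlgebra_ext fun z => by
    simp [hP, hπN, rankOne_apply, hfN, hx]
  have hadj : ∀ Q : nestAlgebra 𝒩, IsIdempotentElem Q →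
      Q ∈ Algebra.adjoin 𝕜 {P : nestAlgebra 𝒩 | IsIdempotentElem P} :=
    fun Q hQ => Algebra.subset_adjoin hQ
  simpa using sub_mem (hadj _ h₂) (hadj _ h₁)

/-- Every rank one operator of the nest algebra lies in the subalgebra generated by the
idempotents. -/
theorem IsNest.rankOne_mem_adjoin (hcompl : nestPred 𝒩 N = N → N.ClosedComplemented) :
    h𝒩.rankOne hN hx hf ∈ Algebra.adjoin 𝕜 {P : nestAlgebra 𝒩 | IsIdempotentElem P} := by
  by_cases hfN : ∃ y ∈ N, f y ≠ 0
  · exact h𝒩.rankOne_mem_adjoin_of_exists_apply_ne_zero hN hx hf hfN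
  push Not at hfN
  by_cases hpred : nestPred 𝒩 N = N
  · exact h𝒩.rankOne_mem_adjoin_of_closedComplemented hN hx hf (hcompl hpred) hfN
  obtain ⟨y, hy, hyN⟩ := SetLike.exists_of_lt (lt_of_le_of_ne (h𝒩.nestPred_le hN) hpred)
  obtain ⟨g, hg, hgy⟩ :=
    Submodule.exists_strongDual_ne_zero_of_notMem (isClosed_nestPred 𝒩 N) hyN
  -- Factor f ⊗ x = g(y)⁻¹ (g ⊗ x)(f ⊗ y) through y ∈ N \ N₋.
  have h₁ := h𝒩.rankOne_mem_adjoin_of_exists_apply_ne_zero hN hx hg ⟨y, hy, hgy⟩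
  have h₂ := h𝒩.rankOne_mem_adjoin_of_exists_functional hN hy hf ⟨g, hg, hgy⟩
  convert Subalgebra.smul_mem _ (mul_mem h₁ h₂) (g y)⁻¹ using 1
  refine nestAlgebra_ext fun z => ?_
  simp [rankOne_apply, smul_smul, mul_left_comm, hgy]

end

/-- An element of the nest algebra annihilated by left multiplication with all rank one operators
of the nest algebra is zero. -/
theorem IsNest.eq_zero_of_rankOne_mul {𝒩 : Set (Submodule 𝕜 X)} (h𝒩 : IsNest 𝒩)
    {T : nestAlgebra 𝒩}
    (hT : ∀ (N : Submodule 𝕜 X) (hN : N ∈ 𝒩) (x : X) (hx : x ∈ N) (f : StrongDual 𝕜 X)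
      (hf : ∀ y ∈ nestPred 𝒩 N, f y = 0), h𝒩.rankOne hN hx hf * T = 0) : T = 0 := by
  refine nestAlgebra_ext fun z => ?_
  have hpred : ∀ N ∈ 𝒩, N ≠ ⊥ → (T : X →L[𝕜] X) z ∈ nestPred 𝒩 N := by
    intro N hN hbot
    by_contra hz
    obtain ⟨f, hf, hfz⟩ :=
      Submodule.exists_strongDual_ne_zero_of_notMem (isClosed_nestPred 𝒩 N) hz
    obtain ⟨x, hx, hx0⟩ := N.exists_mem_ne_zero_of_ne_bot hbot
    have h := DFunLike.congr_fun (congrArg Subtype.val (hT N hN x hx f hf)) z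
    have h' : f ((T : X →L[𝕜] X) z) • x = 0 := h
    exact (smul_ne_zero hfz hx0) h'
  -- If K ≠ 0, it is the least nonzero member of the nest, so K₋ = 0.
  let K : Submodule 𝕜 X := sInf {N | N ∈ 𝒩 ∧ N ≠ ⊥}
  have hK : K ∈ 𝒩 := h𝒩.sInf_mem _ fun _ h => h.1
  have hzK : (T : X →L[𝕜] X) z ∈ K :=
    (Submodule.mem_sInf).2 fun N hN => h𝒩.nestPred_le hN.1 (hpred N hN.1 hN.2)
  by_cases hbot : K = ⊥
  · rw [hbot] at hzK
    simpa using hzK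
  · have hKpred : nestPred 𝒩 K ≤ ⊥ := by
      refine Submodule.topologicalClosure_minimal _ (sSup_le fun M hM => ?_)
        (h𝒩.isClosed _ h𝒩.bot_mem)
      by_contra hM0
      exact hM.2.not_ge (sInf_le ⟨hM.1, fun h => hM0 h.le⟩)
    simpa using hKpred (hpred K hK hbot)

/-- An element of the nest algebra annihilated by right multiplication with all rank one operators
of the nest algebra is zero. -/
theorem IsNest.eq_zero_of_mul_rankOne {𝒩 : Set (Submodule 𝕜 X)} (h𝒩 : IsNest 𝒩)
    {T : nestAlgebra 𝒩}
    (hT : ∀ (N : Submodule 𝕜 X) (hN : N ∈ 𝒩) (x : X) (hx : x ∈ N) (f : StrongDual 𝕜 X)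
      (hf : ∀ y ∈ nestPred 𝒩 N, f y = 0), T * h𝒩.rankOne hN hx hf = 0) : T = 0 := by
  have hker : ∀ N ∈ 𝒩, nestPred 𝒩 N ≠ ⊤ → N ≤ (T : X →L[𝕜] X).ker := by
    intro N hN htop x hx
    obtain ⟨y, -, hy⟩ := SetLike.exists_of_lt (lt_top_iff_ne_top.2 htop)
    obtain ⟨f, hf, hfy⟩ :=
      Submodule.exists_strongDual_ne_zero_of_notMem (isClosed_nestPred 𝒩 N) hy
    have h := DFunLike.congr_fun (congrArg Subtype.val (hT N hN x hx f hf)) y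
    have h' : (T : X →L[𝕜] X) (f y • x) = 0 := h
    rw [map_smul] at h'
    exact (smul_eq_zero.1 h').resolve_left hfy
  have htop : (⊤ : Submodule 𝕜 X) ≤ (T : X →L[𝕜] X).ker := by
    -- If X₋ = X, the proper members, all inside ker T, have dense span.
    by_cases hpred : nestPred 𝒩 ⊤ = ⊤
    · rw [← hpred]
      refine Submodule.topologicalClosure_minimal _ (sSup_le fun M hM => ?_)
        (T : X →L[𝕜] X).isClosed_ker
      exact hker M hM.1 ((h𝒩.nestPred_le hM.1).trans_lt hM.2).ne
    · exact hker ⊤ h𝒩.top_mem hpred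
  exact nestAlgebra_ext fun z => htop (Submodule.mem_top (x := z))

theorem IsNest.eq_mul_map_one {𝒩 : Set (Submodule 𝕜 X)} (h𝒩 : IsNest 𝒩)
    (hcompl : ∀ N ∈ 𝒩, nestPred 𝒩 N = N → N.ClosedComplemented)
    {τ : nestAlgebra 𝒩 →ₗ[𝕜] nestAlgebra 𝒩}
    (hτ : ∀ A B : nestAlgebra 𝒩, A * B = 0 → A * τ B = 0) (A : nestAlgebra 𝒩) :
    τ A = A * τ 1 := by
  refine sub_eq_zero.1 (h𝒩.eq_zero_of_rankOne_mul fun N hN x hx f hf => ?_)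
  have h₁ := map_mul_left_of_mem_adjoin_idempotents hτ
    (h𝒩.rankOne_mem_adjoin hN hx hf (hcompl N hN)) A
  -- RA = (f ∘ A) ⊗ x, and A preserves every M < N, so f ∘ A still kills N₋.
  have hfA : ∀ y ∈ nestPred 𝒩 N, f.comp (A : X →L[𝕜] X) y = 0 := by
    have : nestPred 𝒩 N ≤ (f.comp (A : X →L[𝕜] X)).ker := by
      refine Submodule.topologicalClosure_minimal _ (sSup_le fun M hM y hy => ?_)
        (f.comp (A : X →L[𝕜] X)).isClosed_ker
      exact hf _ (le_nestPred hM.1 hM.2 (A.2 M hM.1 y hy))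
    exact fun y hy => this hy
  have h₂ := map_mul_left_of_mem_adjoin_idempotents hτ
    (h𝒩.rankOne_mem_adjoin hN hx hfA (hcompl N hN)) 1
  have hmul : h𝒩.rankOne hN hx hfA = h𝒩.rankOne hN hx hf * A := rfl
  rw [mul_one, hmul] at h₂
  rw [mul_sub, ← h₁, h₂, mul_assoc, sub_self]

/-- Here AR = f ⊗ Ax with Ax ∈ N replaces RA. -/
theorem IsNest.eq_map_one_mul {𝒩 : Set (Submodule 𝕜 X)} (h𝒩 : IsNest 𝒩)
    (hcompl : ∀ N ∈ 𝒩, nestPred 𝒩 N = N → N.ClosedComplemented)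
    {δ : nestAlgebra 𝒩 →ₗ[𝕜] nestAlgebra 𝒩}
    (hδ : ∀ A B : nestAlgebra 𝒩, A * B = 0 → δ A * B = 0) (A : nestAlgebra 𝒩) :
    δ A = δ 1 * A := by
  refine sub_eq_zero.1 (h𝒩.eq_zero_of_mul_rankOne fun N hN x hx f hf => ?_)
  have h₁ := map_mul_right_of_mem_adjoin_idempotents hδ
    (h𝒩.rankOne_mem_adjoin hN hx hf (hcompl N hN)) A
  have h₂ := map_mul_right_of_mem_adjoin_idempotents hδ
    (h𝒩.rankOne_mem_adjoin hN (A.2 N hN x hx) hf (hcompl N hN)) 1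
  have hmul : h𝒩.rankOne hN (A.2 N hN x hx) hf = A * h𝒩.rankOne hN hx hf :=
    nestAlgebra_ext fun z => by simp [rankOne_apply]
  rw [one_mul, hmul] at h₂
  rw [sub_mul, ← h₁, h₂, mul_assoc, sub_self]

end NestRankOne

theorem corollary3p3 {𝕜 X : Type*} [RCLike 𝕜] [NormedAddCommGroup X] [NormedSpace 𝕜 X]
    [CompleteSpace X] (hdim : 2 ≤ Module.rank 𝕜 X)
    (𝒩 : Set (Submodule 𝕜 X)) (h𝒩 : IsNest 𝒩)
    (hcompl : ∀ N ∈ 𝒩, nestPred 𝒩 N = N → N.ClosedComplemented)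
    (τ δ ρ : nestAlgebra 𝒩 →ₗ[𝕜] nestAlgebra 𝒩) :
    ((∀ A B : nestAlgebra 𝒩, A * B = 0 → A * τ B = 0) ↔
      ∃ D : nestAlgebra 𝒩, ∀ A : nestAlgebra 𝒩, τ A = A * D) ∧
    ((∀ A B : nestAlgebra 𝒩, A * B = 0 → δ A * B = 0) ↔
      ∃ D : nestAlgebra 𝒩, ∀ A : nestAlgebra 𝒩, δ A = D * A) ∧
    ((∀ A B : nestAlgebra 𝒩, A * B = 0 → A * ρ B = 0 ∧ ρ A * B = 0) ↔
      ∃ D : nestAlgebra 𝒩, (∀ A : nestAlgebra 𝒩, ρ A = A * D) ∧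
        ∀ A : nestAlgebra 𝒩, A * D = D * A) := by
  refine ⟨⟨fun h => ⟨τ 1, h𝒩.eq_mul_map_one hcompl h⟩, ?_⟩,
    ⟨fun h => ⟨δ 1, h𝒩.eq_map_one_mul hcompl h⟩, ?_⟩, ⟨fun h => ⟨ρ 1, ?_⟩, ?_⟩⟩
  · rintro ⟨D, hD⟩ A B hAB
    rw [hD, ← mul_assoc, hAB, zero_mul]
  · rintro ⟨D, hD⟩ A B hAB
    rw [hD, mul_assoc, hAB, mul_zero]
  · have hleft := h𝒩.eq_mul_map_one hcompl fun A B hAB => (h A B hAB).1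
    have hright := h𝒩.eq_map_one_mul hcompl fun A B hAB => (h A B hAB).2
    exact ⟨hleft, fun A => (hleft A).symm.trans (hright A)⟩
  · rintro ⟨D, hD, hcomm⟩ A B hAB
    refine ⟨by rw [hD, ← mul_assoc, hAB, zero_mul], ?_⟩
    rw [hD, hcomm, mul_assoc, hAB, mul_zero]
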